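/- Let $X\neq\{0\}$ be a Banach sequence space, i.e. a complex Banach space consisting of complex sequences $x=(x(k))_{k\in\mathbb N}$ (with the coordinatewise vector operations) such that whenever $x$ is a complex sequence with $|x(k)|\le |y(k)|$ for all $k$ and some $y\in X$, then $x\in X$ and $\|x\|\le\|y\|$. Let $B_X$ be the closed unit ball and $S_X$ the unit sphere of $X$. Assume that $X$ is order continuous: every sequence $(x_n)$ in $X$ with $0\le x_1\le x_2\le\cdots\le y$ for some positive $y\in X$ is norm-convergent, where $u\le v$ means that $v(k)-u(k)$ is real and nonnegative for every $k$. Assume also that $X$ is locally c-convex, that is: (i) every $x\in S_X$ is a complex extreme point of $B_X$: for every nonzero $y\in X$ there is $\zeta\in\mathbb C$ with $|\zeta|\le1$ and $x+\zeta y\notin B_X$; (ii) every $x\in S_X$ has a strong face: for each $\epsilon>0$ there is $\delta>0$ such that for all $y\in X$ with $\operatorname{dist}(y,\mathcal F(x))\ge\epsilon$ one has $$\sup_{0\le\theta\le2\pi}\|x+e^{i\theta}(x-y)\|\ge1+\delta,$$ where $\mathcal F(x)=\{x+y: y\in X,\ \sup_{|\zeta|\le1}\|x+\zeta y\|\le1\}$.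 Let $\mathcal A_b(B_X)$ be the algebra of bounded continuous functions $f:B_X\to\mathbb C$ that are holomorphic on the open unit ball, with the norm $\|f\|=\sup_{x\in B_X}|f(x)|$, and let $\mathcal A_u(B_X)$ be the subalgebra of those $f\in\mathcal A_b(B_X)$ that are uniformly continuous on $B_X$. For $\mathcal A$ either of these algebras, a set $F\subset B_X$ is called a boundary for $\mathcal A$ if $\|f\|=\sup_{x\in F}|f(x)|$ for all $f\in\mathcal A$; if the intersection of all closed boundaries for $\mathcal A$ is again a boundary for $\mathcal A$, this intersection is called the Shilov boundary for $\mathcal A$. Then $S_X$ is the Shilov boundary for $\mathcal A_u(B_X)$ and also the Shilov boundary for $\mathcal A_b(B_X)$. -/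

import Mathlib

open Set Filter Topology Metric
open scoped BoundedContinuousFunction

/-! ### Function algebras, boundaries and the Shilov boundary -/

section Boundary

variable {K : Type*} [TopologicalSpace K]

/-- A subset `F` of `K` is a boundary for the function algebra `A ⊆ C_b(K)` if
`‖f‖ = sup_{x ∈ F} |f x|` for all `f ∈ A`. -/
def IsBoundary (A : Subalgebra ℂ (K →ᵇ ℂ)) (F : Set K) : Prop :=
  ∀ f ∈ A, ‖f‖ = ⨆ x : F, ‖f x‖

/-- `S` is the Shilov boundary for `A`: it is the intersection of all closed boundaries for `A`,
and this intersection is itself a boundary for `A`. -/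
def IsShilovBoundary (A : Subalgebra ℂ (K →ᵇ ℂ)) (S : Set K) : Prop :=
  S = ⋂₀ {F : Set K | IsClosed F ∧ IsBoundary A F} ∧ IsBoundary A S

end Boundary

/-! ### The ball algebras -/

section BallAlgebras

variable (X : Type*) [NormedAddCommGroup X] [NormedSpace ℂ X]

/-- `A_b(B_X)`: the bounded continuous functions on the closed unit ball `B_X` that are holomorphic
(complex Fréchet differentiable) on the open unit ball. -/
def ballAlgebraB : Subalgebra ℂ (closedBall (0 : X) 1 →ᵇ ℂ) where
  carrier := {f | ∃ g : X → ℂ, DifferentiableOn ℂ g (ball 0 1) ∧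
    ∀ x : closedBall (0 : X) 1, g x = f x}
  mul_mem' := by
    rintro f₁ f₂ ⟨g₁, h₁, e₁⟩ ⟨g₂, h₂, e₂⟩
    exact ⟨fun x => g₁ x * g₂ x, h₁.mul h₂, fun x => by simp [e₁, e₂]⟩
  add_mem' := by
    rintro f₁ f₂ ⟨g₁, h₁, e₁⟩ ⟨g₂, h₂, e₂⟩
    exact ⟨fun x => g₁ x + g₂ x, h₁.add h₂, fun x => by simp [e₁, e₂]⟩
  algebraMap_mem' := fun c =>
    ⟨fun _ => c, differentiableOn_const c, fun _ => rfl⟩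

/-- `A_u(B_X)`: the functions in `A_b(B_X)` that are uniformly continuous on `B_X`. -/
def ballAlgebraU : Subalgebra ℂ (closedBall (0 : X) 1 →ᵇ ℂ) where
  carrier := {f | f ∈ ballAlgebraB X ∧ UniformContinuous f}
  mul_mem' := by
    rintro f g ⟨hf, uf⟩ ⟨hg, ug⟩
    refine ⟨mul_mem hf hg, ?_⟩
    rw [Metric.uniformContinuous_iff] at uf ug ⊢
    intro ε hε
    have hC : 0 < ‖f‖ + ‖g‖ + 1 := by positivity
    obtain ⟨d₁, hd₁, H₁⟩ := uf (ε / (‖f‖ + ‖g‖ + 1)) (by positivity)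
    obtain ⟨d₂, hd₂, H₂⟩ := ug (ε / (‖f‖ + ‖g‖ + 1)) (by positivity)
    refine ⟨min d₁ d₂, lt_min hd₁ hd₂, fun a b hab => ?_⟩
    have h₁ := (H₁ (lt_of_lt_of_le hab (min_le_left _ _))).le
    have h₂ := (H₂ (lt_of_lt_of_le hab (min_le_right _ _))).le
    rw [dist_eq_norm] at h₁ h₂ ⊢
    have e : (f * g) a - (f * g) b = f a * (g a - g b) + (f a - f b) * g b := by
      simp only [BoundedContinuousFunction.mul_apply]; ring
    rw [e]
    set t := ε / (‖f‖ + ‖g‖ + 1) with ht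
    have ht0 : 0 < t := by positivity
    have hte : t * (‖f‖ + ‖g‖ + 1) = ε := by rw [ht]; field_simp
    calc _ ≤ ‖f a‖ * ‖g a - g b‖ + ‖f a - f b‖ * ‖g b‖ := by
            refine (norm_add_le _ _).trans ?_
            rw [norm_mul, norm_mul]
      _ ≤ ‖f‖ * t + t * ‖g‖ := by
            gcongr
            · exact f.norm_coe_le_norm a
            · exact g.norm_coe_le_norm b
      _ < ε := by nlinarith
  add_mem' := by
    rintro f g ⟨hf, uf⟩ ⟨hg, ug⟩
    exact ⟨add_mem hf hg, uf.add ug⟩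
  algebraMap_mem' := fun c =>
    ⟨algebraMap_mem _ c, uniformContinuous_const (b := c)⟩

/-- The unit sphere `S_X`, as a subset of the closed unit ball `B_X`. -/
def unitSphereInBall : Set (closedBall (0 : X) 1) := {x | ‖(x : X)‖ = 1}

end BallAlgebras

/-! ### Complex convexity -/

section ComplexConvexity

variable {X : Type*} [NormedAddCommGroup X] [NormedSpace ℂ X]

/-- `x` is a complex extreme point of the set `M`. -/
def IsComplexExtremePoint (M : Set X) (x : X) : Prop :=
  x ∈ M ∧ ∀ y : X, y ≠ 0 → ∃ ζ : ℂ, ‖ζ‖ ≤ 1 ∧ x + ζ • y ∉ M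

/-- The face `F(x) = {x + y : sup_{|ζ| ≤ 1} ‖x + ζ y‖ ≤ 1}` at `x`. -/
def complexFace (x : X) : Set X :=
  {z | ∃ y : X, (∀ ζ : ℂ, ‖ζ‖ ≤ 1 → ‖x + ζ • y‖ ≤ 1) ∧ z = x + y}

/-- `x` has a strong face: for each `ε > 0` there is `δ > 0` such that `dist(F(x), y) ≥ ε` implies
`sup_{0 ≤ θ ≤ 2π} ‖x + e^{iθ}(x - y)‖ ≥ 1 + δ`. -/
def HasStrongFace (x : X) : Prop :=
  ∀ ε : ℝ, 0 < ε → ∃ δ : ℝ, 0 < δ ∧ ∀ y : X, ε ≤ infDist y (complexFace x) →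
    1 + δ ≤ ⨆ θ : Icc (0 : ℝ) (2 * Real.pi),
      ‖x + Complex.exp ((θ : ℝ) * Complex.I) • (x - y)‖

variable (X)

/-- Every point of the unit sphere is a complex extreme point of the closed unit ball. -/
def IsStrictlyCConvex : Prop :=
  ∀ x : X, ‖x‖ = 1 → IsComplexExtremePoint (closedBall (0 : X) 1) x

/-- `X` is strictly c-convex and every point of the unit sphere has a strong face. -/
def IsLocallyCConvex : Prop :=
  IsStrictlyCConvex X ∧ ∀ x : X, ‖x‖ = 1 → HasStrongFace x

end ComplexConvexity

/-! ### Banach sequence spaces -/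

/-- A realization of the complex normed space `X` as a normed space of complex sequences which is
solid: each `x : X` is identified with the sequence `coord x` of its coordinates, and if a sequence
`x` satisfies `|x| ≤ |y|` for some `y` in `X`, then `x` is in `X` and `‖x‖ ≤ ‖y‖`.
If `X` is complete this makes `X` a Banach sequence space. -/
structure SequenceSpaceStructure (X : Type*) [NormedAddCommGroup X] [NormedSpace ℂ X] where
  /-- The sequence of coordinates of an element of `X`. -/
  coord : X →ₗ[ℂ] (ℕ → ℂ)
  coord_injective : Function.Injective coord
  solid : ∀ (x : ℕ → ℂ) (y : X), (∀ k, ‖x k‖ ≤ ‖coord y k‖) → ∃ z : X, coord z = x ∧ ‖z‖ ≤ ‖y‖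

/-- Order continuity: every sequence `0 ≤ x₁ ≤ x₂ ≤ ⋯ ≤ y` in `X` is norm-convergent. The order is
the coordinatewise one, `x ≤ y` meaning that every coordinate of `y - x` is real and nonnegative. -/
def SequenceSpaceStructure.OrderContinuous {X : Type*} [NormedAddCommGroup X] [NormedSpace ℂ X]
    (E : SequenceSpaceStructure X) : Prop :=
  ∀ (x : ℕ → X) (y : X),
    (∀ k, ∃ r : ℝ, 0 ≤ r ∧ E.coord (x 0) k = r) →
    (∀ n k, ∃ r : ℝ, 0 ≤ r ∧ E.coord (x (n + 1) - x n) k = r) →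
    (∀ n k, ∃ r : ℝ, 0 ≤ r ∧ E.coord (y - x n) k = r) →
    ∃ l : X, Tendsto x atTop (𝓝 l)

/-!
The sphere is a boundary for `A_b` by the maximum modulus principle, so everything reduces to showing
that a closed boundary `F` for `A_u` meets every ball around every unit vector. By order continuity,
unit vectors with finitely many nonzero coordinates are dense in the sphere
(`SequenceSpaceStructure.exists_finite_support_near`), so it is enough to produce, for such a unit
vector `x` and each `r > 0`, a function in `A_u` with value `1` at `x` and modulus at most `1 / 2` on
the points of the ball at distance at least `r` from `x`
(`SequenceSpaceStructure.exists_concentrated`).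

Write `w k = y k / x k` for `k` in the support of `x`. A functional `φ` norming `x` gives weights
`p k = |φ (x k • e k)|` with `∑ p k = 1` and, by solidity, `∑ p k * |w k| ≤ 1` for all `y` in the unit
ball. Strict c-convexity forces every `p k` to be positive: if `p k = 0`, then `x` with its `k`-th
coordinate removed still has norm one, and it fails to be complex extreme in the direction `e k`
(`SequenceSpaceStructure.exists_weights`). By weighted AM-GM, the function
`F(w) = ∏ |w k| ^ p k * |1 + ∑ p k * w k| / 2` is at most `1`, with equality only for `w = 1`, and by
compactness it is bounded away from `1` off neighbourhoods of `w = 1` (`exists_peakModel_le`). The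
polynomials `∏ w k ^ ⌈N * p k⌉ * ((1 + ∑ p k * w k) / 2) ^ N` are bounded by a constant times
`F(w) ^ N` (`norm_peakPolynomial_le`), so for large `N` they concentrate at `w = 1`.

Finally, closeness of `w` to `1` implies closeness of `y` to `x`
(`SequenceSpaceStructure.exists_norm_sub_lt`): if `z` is the part of `y` off the support of `x`, then
`‖x + e^{iθ} z‖ = ‖x + z‖` for all `θ` by solidity, which is at most `1` plus a small error, and the
strong face condition, where the face is `{x}` by strict c-convexity, makes `z` small.
-/

/-! ### A peaking function on a weighted `ℓ¹` ball -/

section Model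

variable {ι : Type*} [Fintype ι] {p : ι → ℝ}

/-- `F(w) = ∏ |w k| ^ p k * |1 + ∑ p k * w k| / 2`: the `N`-th root, up to rounding of the exponents,
of the modulus of the peaking polynomials. -/
noncomputable def peakModel (p : ι → ℝ) (w : ι → ℂ) : ℝ :=
  (∏ k, ‖w k‖ ^ p k) * ‖(1 + ∑ k, p k * w k) / 2‖

theorem norm_sum_weighted_le (hp : ∀ k, 0 < p k) (w : ι → ℂ) :
    ‖∑ k, (p k : ℂ) * w k‖ ≤ ∑ k, p k * ‖w k‖ :=
  (norm_sum_le _ _).trans_eq <| Finset.sum_congr rfl fun k _ => by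
    rw [norm_mul, Complex.norm_of_nonneg (hp k).le]

theorem norm_one_add_div_two_le {s : ℂ} (hs : ‖s‖ ≤ 1) : ‖(1 + s) / 2‖ ≤ 1 := by
  have := norm_add_le 1 s
  rw [norm_div, Complex.norm_ofNat]
  rw [norm_one] at this
  linarith

theorem prod_rpow_norm_le_one (hp : ∀ k, 0 < p k) (hp1 : ∑ k, p k = 1) {w : ι → ℂ}
    (hw : ∑ k, p k * ‖w k‖ ≤ 1) : ∏ k, ‖w k‖ ^ p k ≤ 1 :=
  (Real.geom_mean_le_arith_mean_weighted _ _ _ (fun k _ => (hp k).le) hp1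
    fun _ _ => norm_nonneg _).trans hw

theorem continuous_peakModel (hp : ∀ k, 0 < p k) : Continuous (peakModel p) := by
  refine Continuous.mul (continuous_finsetProd _ fun k _ => ?_) (by fun_prop)
  exact (continuous_apply k).norm.rpow_const fun _ => Or.inr (hp k).le

theorem peakModel_nonneg (w : ι → ℂ) : 0 ≤ peakModel p w := by
  unfold peakModel; positivity

/-- The AM-GM factor reaches `1` only when all `|w k| = 1`, and the second factor then singles out
`w = 1` on this torus. -/
theorem eq_one_of_one_le_peakModel (hp : ∀ k, 0 < p k) (hp1 : ∑ k, p k = 1) {w : ι → ℂ}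
    (hw : ∑ k, p k * ‖w k‖ ≤ 1) (h : 1 ≤ peakModel p w) : w = 1 := by
  have hs := (norm_sum_weighted_le hp w).trans hw
  have h1 := norm_one_add_div_two_le hs
  have h2 := prod_rpow_norm_le_one hp hp1 hw
  have h0 : 0 ≤ ∏ k, ‖w k‖ ^ p k := by positivity
  unfold peakModel at h
  have hprod : ∏ k, ‖w k‖ ^ p k = 1 := by
    nlinarith [norm_nonneg ((1 + ∑ k, (p k : ℂ) * w k) / 2)]
  have hhalf : ‖(1 + ∑ k, (p k : ℂ) * w k) / 2‖ = 1 := by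
    rw [hprod, one_mul] at h; exact le_antisymm h1 h
  have hamgm := Real.geom_mean_le_arith_mean_weighted Finset.univ p (fun k => ‖w k‖)
    (fun k _ => (hp k).le) hp1 fun _ _ => norm_nonneg _
  have hsum : ∑ k, p k * ‖w k‖ = 1 := le_antisymm hw (hprod ▸ hamgm)
  have hnorm : ∀ k, ‖w k‖ = 1 := by
    have := (Real.geom_mean_eq_arith_mean_weighted_iff_of_pos' Finset.univ p (fun k => ‖w k‖)
      (fun k _ => hp k) hp1 fun _ _ => norm_nonneg _).1 (hprod.trans hsum.symm)
    intro k
    have := this k (Finset.mem_univ k)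
    rw [this, hsum]
  have hre1 : ∀ k, (w k).re ≤ 1 := fun k => (Complex.re_le_norm _).trans_eq (hnorm k)
  -- The equality case of the triangle inequality for `1` and the weighted mean.
  have hre : ∑ k, p k * (w k).re = 1 := by
    set s := ∑ k, (p k : ℂ) * w k with hsdef
    have e : s.re = ∑ k, p k * (w k).re := by simp [hsdef]
    rw [← e]
    rw [norm_div, Complex.norm_ofNat] at hhalf
    have h4 : ‖1 + s‖ ^ 2 = 4 := by
      have : ‖1 + s‖ = 2 := by linarith
      rw [this]; norm_num
    have h5 : ‖s‖ ^ 2 ≤ 1 := pow_le_one₀ (norm_nonneg _) hs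
    rw [Complex.sq_norm, Complex.normSq_apply] at h4 h5
    simp only [Complex.add_re, Complex.one_re, Complex.add_im, Complex.one_im, zero_add] at h4
    have := (Complex.re_le_norm s).trans hs
    nlinarith
  have hre2 : ∀ k, (w k).re = 1 := by
    have h6 : ∑ k, p k * (w k).re = ∑ k, p k * 1 := by simp [hre, hp1]
    intro k
    have := (Finset.sum_eq_sum_iff_of_le fun k _ =>
      mul_le_mul_of_nonneg_left (hre1 k) (hp k).le).1 h6 k (Finset.mem_univ k)
    exact mul_left_cancel₀ (hp k).ne' this
  funext k
  have h7 : ‖w k‖ ^ 2 = 1 := by rw [hnorm k]; norm_num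
  rw [Complex.sq_norm, Complex.normSq_apply, hre2 k] at h7
  exact Complex.ext (by simp [hre2 k]) (by simp; nlinarith)

theorem norm_apply_le_of_weighted (hp : ∀ k, 0 < p k) {w : ι → ℂ}
    (hw : ∑ k, p k * ‖w k‖ ≤ 1) (k : ι) : ‖w k‖ ≤ 1 + ∑ j, (p j)⁻¹ := by
  have h1 : p k * ‖w k‖ ≤ 1 := (Finset.single_le_sum (f := fun k => p k * ‖w k‖)
    (fun j _ => mul_nonneg (hp j).le (norm_nonneg _)) (Finset.mem_univ k)).trans hw
  have h2 : (p k)⁻¹ ≤ ∑ j, (p j)⁻¹ := Finset.single_le_sum (f := fun j => (p j)⁻¹)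
    (fun j _ => (inv_pos.2 (hp j)).le) (Finset.mem_univ k)
  have h3 : ‖w k‖ ≤ (p k)⁻¹ := by
    rw [← mul_one (p k)⁻¹]
    exact (le_inv_mul_iff₀ (hp k)).2 h1
  linarith

/-- Rounding a real exponent up costs at most one factor `C`. Rounding up, unlike down, is harmless
when `t` is near `0`. -/
theorem pow_ceil_le {t C q : ℝ} (ht : 0 ≤ t) (htC : t ≤ C) (hC : 1 ≤ C) (hq : 0 < q) (N : ℕ) :
    t ^ ⌈N * q⌉₊ ≤ C * (t ^ q) ^ N := by
  have hNq : 0 ≤ N * q := by positivity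
  have hd0 : 0 ≤ (⌈N * q⌉₊ : ℝ) - N * q := sub_nonneg.2 (Nat.le_ceil _)
  have hd1 : (⌈N * q⌉₊ : ℝ) - N * q ≤ 1 := by linarith [Nat.ceil_lt_add_one hNq]
  have e : t ^ ⌈N * q⌉₊ = t ^ ((⌈N * q⌉₊ : ℝ) - N * q) * (t ^ q) ^ N := by
    rw [← Real.rpow_natCast, ← Real.rpow_natCast, ← Real.rpow_mul ht,
      ← Real.rpow_add_of_nonneg ht hd0 (by positivity)]
    congr 1; ring
  rw [e]
  gcongr
  calc t ^ ((⌈N * q⌉₊ : ℝ) - N * q) ≤ C ^ ((⌈N * q⌉₊ : ℝ) - N * q) :=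
        Real.rpow_le_rpow ht htC hd0
    _ ≤ C ^ (1 : ℝ) := Real.rpow_le_rpow_of_exponent_le hC hd1
    _ = C := Real.rpow_one C

/-- The constant in front does not depend on `N`, so that the polynomials decay geometrically
wherever `peakModel` stays away from `1`. -/
theorem norm_peakPolynomial_le (hp : ∀ k, 0 < p k) {w : ι → ℂ}
    (hw : ∑ k, p k * ‖w k‖ ≤ 1) (N : ℕ) :
    ‖(∏ k, w k ^ ⌈N * p k⌉₊) * ((1 + ∑ k, p k * w k) / 2) ^ N‖ ≤
      (1 + ∑ j, (p j)⁻¹) ^ Fintype.card ι * peakModel p w ^ N := by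
  have h0 : 0 ≤ ∑ j, (p j)⁻¹ := Finset.sum_nonneg fun j _ => (inv_pos.2 (hp j)).le
  have h : ∏ k, ‖w k‖ ^ ⌈N * p k⌉₊ ≤ ∏ k, ((1 + ∑ j, (p j)⁻¹) * (‖w k‖ ^ p k) ^ N) :=
    Finset.prod_le_prod (fun k _ => by positivity) fun k _ =>
      pow_ceil_le (norm_nonneg _) (norm_apply_le_of_weighted hp hw k) (by linarith) (hp k) N
  rw [Finset.prod_mul_distrib, Finset.prod_const, Finset.card_univ, Finset.prod_pow] at h
  rw [norm_mul, norm_prod, norm_pow, peakModel, mul_pow, ← mul_assoc]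
  simp only [norm_pow]
  gcongr

theorem exists_peakModel_le (hp : ∀ k, 0 < p k) (hp1 : ∑ k, p k = 1) {r : ℝ} (hr : 0 < r) :
    ∃ η : ℝ, 0 ≤ η ∧ η < 1 ∧ ∀ w : ι → ℂ, ∑ k, p k * ‖w k‖ ≤ 1 → r ≤ ‖w - 1‖ →
      peakModel p w ≤ η := by
  -- Positivity of all the weights makes the weighted `ℓ¹` ball, hence `S`, compact.
  set S : Set (ι → ℂ) := {w | ∑ k, p k * ‖w k‖ ≤ 1 ∧ r ≤ ‖w - 1‖} with hS
  have hc : IsCompact S := by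
    refine Metric.isCompact_of_isClosed_isBounded ?_ ?_
    · have h1 : Continuous fun w : ι → ℂ => ∑ k, p k * ‖w k‖ := by fun_prop
      have h2 : Continuous fun w : ι → ℂ => ‖w - 1‖ := by fun_prop
      exact (isClosed_le h1 continuous_const).inter (isClosed_le continuous_const h2)
    · refine isBounded_iff_forall_norm_le.2 ⟨1 + ∑ j, (p j)⁻¹, fun w hw => ?_⟩
      have h0 : 0 ≤ ∑ j, (p j)⁻¹ := Finset.sum_nonneg fun j _ => (inv_pos.2 (hp j)).le
      exact (pi_norm_le_iff_of_nonneg (by linarith)).2 fun k => norm_apply_le_of_weighted hp hw.1 k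
  rcases S.eq_empty_or_nonempty with he | hne
  · exact ⟨0, le_rfl, one_pos, fun w h1 h2 => absurd (show w ∈ S from ⟨h1, h2⟩) (by simp [he])⟩
  · obtain ⟨w₀, hw₀, hmax⟩ := hc.exists_isMaxOn hne (continuous_peakModel hp).continuousOn
    refine ⟨peakModel p w₀, peakModel_nonneg _, ?_, fun w h1 h2 => hmax ⟨h1, h2⟩⟩
    by_contra! h
    have := eq_one_of_one_le_peakModel hp hp1 hw₀.1 h
    have h3 := hw₀.2
    rw [this, sub_self, norm_zero] at h3
    linarith

end Model

/-! ### Band projections, coordinates and density of finite supports -/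

namespace SequenceSpaceStructure

variable {X : Type*} [NormedAddCommGroup X] [NormedSpace ℂ X] (E : SequenceSpaceStructure X)

theorem norm_le_of_coord_le {x y : X} (h : ∀ k, ‖E.coord x k‖ ≤ ‖E.coord y k‖) : ‖x‖ ≤ ‖y‖ := by
  obtain ⟨z, hz, hzy⟩ := E.solid _ y h
  exact E.coord_injective hz ▸ hzy

theorem norm_eq_of_norm_coord_eq {x y : X} (h : ∀ k, ‖E.coord x k‖ = ‖E.coord y k‖) :
    ‖x‖ = ‖y‖ :=
  le_antisymm (E.norm_le_of_coord_le fun k => (h k).le) (E.norm_le_of_coord_le fun k => (h k).ge)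

theorem exists_indicator (s : Set ℕ) (x : X) : ∃ z : X, E.coord z = s.indicator (E.coord x) := by
  obtain ⟨z, hz, -⟩ := E.solid (s.indicator (E.coord x)) x fun k => norm_indicator_le_norm_self _ _
  exact ⟨z, hz⟩

/-- The band projection onto the coordinates in `s`. -/
noncomputable def proj (s : Set ℕ) (x : X) : X := (E.exists_indicator s x).choose

@[simp] theorem coord_proj (s : Set ℕ) (x : X) : E.coord (E.proj s x) = s.indicator (E.coord x) :=
  (E.exists_indicator s x).choose_spec

/-- Coordinate functionals are bounded: the `k`-th component of `x` has norm at most `‖x‖`. If no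
vector has a nonzero `k`-th coordinate, the functional vanishes. -/
theorem exists_norm_coord_le (k : ℕ) : ∃ C : ℝ, ∀ x : X, ‖E.coord x k‖ ≤ C * ‖x‖ := by
  by_cases h : ∀ x : X, E.coord x k = 0
  · exact ⟨0, fun x => by simp [h x]⟩
  push Not at h
  obtain ⟨u, hu⟩ := h
  set e := E.proj {k} u with he
  have hek : E.coord e k = E.coord u k := by simp [he]
  have he0 : e ≠ 0 := fun h => hu (by rw [← hek, h]; simp)
  have hpos : 0 < ‖e‖ := norm_pos_iff.2 he0
  refine ⟨‖E.coord u k‖ / ‖e‖, fun x => ?_⟩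
  have h1 : ‖(E.coord x k / E.coord u k) • e‖ ≤ ‖x‖ := E.norm_le_of_coord_le fun j => by
    by_cases hj : j = k
    · subst hj
      simp [hek, div_mul_cancel₀ _ hu]
    · simp [he, hj]
  rw [norm_smul, norm_div] at h1
  have hu' : 0 < ‖E.coord u k‖ := norm_pos_iff.2 hu
  calc ‖E.coord x k‖ = ‖E.coord u k‖ / ‖e‖ * (‖E.coord x k‖ / ‖E.coord u k‖ * ‖e‖) := by
        field_simp
    _ ≤ _ := by gcongr

/-- The `k`-th coordinate as a continuous linear functional. -/
noncomputable def coordCLM (k : ℕ) : X →L[ℂ] ℂ :=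
  ((LinearMap.proj k).comp E.coord).mkContinuousOfExistsBound (E.exists_norm_coord_le k)

@[simp] theorem coordCLM_apply (k : ℕ) (x : X) : E.coordCLM k x = E.coord x k := rfl

/-- Order continuity applied to the truncations of `|x|`, whose distance to `|x|` is the distance
of the truncations of `x` to `x`. -/
theorem tendsto_proj (hE : E.OrderContinuous) (x : X) :
    Tendsto (fun n : ℕ => E.proj (Iio n) x) atTop (𝓝 x) := by
  obtain ⟨a, ha, -⟩ := E.solid (fun k => (‖E.coord x k‖ : ℂ)) x fun k => by simp
  obtain ⟨l, hl⟩ := hE (fun n => E.proj (Iio n) a) a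
    (fun k => ⟨0, le_rfl, by simp⟩)
    (fun n k => by
      simp only [map_sub, coord_proj, Pi.sub_apply, ha, indicator_apply, mem_Iio]
      rcases lt_trichotomy k n with h | h | h
      · exact ⟨0, le_rfl, by simp [h, h.trans (Nat.lt_succ_self n)]⟩
      · exact ⟨‖E.coord x k‖, norm_nonneg _, by simp [h]⟩
      · exact ⟨0, le_rfl, by simp [h.not_gt, (Nat.succ_le_of_lt h).not_gt]⟩)
    (fun n k => by
      simp only [map_sub, coord_proj, Pi.sub_apply, ha, indicator_apply, mem_Iio]
      by_cases h : k < n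
      · exact ⟨0, le_rfl, by simp [h]⟩
      · exact ⟨‖E.coord x k‖, norm_nonneg _, by simp [h]⟩)
  have hla : l = a := by
    refine E.coord_injective (funext fun k => ?_)
    have h1 := ((E.coordCLM k).continuous.tendsto l).comp hl
    refine tendsto_nhds_unique h1 (tendsto_const_nhds.congr' ?_)
    filter_upwards [eventually_gt_atTop k] with n hn
    simp [hn]
  rw [hla, tendsto_iff_norm_sub_tendsto_zero] at hl
  rw [tendsto_iff_norm_sub_tendsto_zero]
  refine hl.congr fun n => E.norm_eq_of_norm_coord_eq fun k => ?_
  by_cases h : k < n <;> simp [h, ha]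

/-- Unit vectors with finitely many nonzero coordinates are dense in the unit sphere. -/
theorem exists_finite_support_near (hE : E.OrderContinuous) {x : X} (hx : ‖x‖ = 1) {r : ℝ}
    (hr : 0 < r) : ∃ y : X, ‖y‖ = 1 ∧ (Function.support (E.coord y)).Finite ∧ ‖y - x‖ < r := by
  have hx0 : x ≠ 0 := fun h => by simp [h] at hx
  have h1 := E.tendsto_proj hE x
  have h2 : Tendsto (fun n : ℕ => ((‖E.proj (Iio n) x‖⁻¹ : ℝ) : ℂ) • E.proj (Iio n) x) atTop
      (𝓝 x) := by
    have h3 : Tendsto (fun n : ℕ => ((‖E.proj (Iio n) x‖⁻¹ : ℝ) : ℂ)) atTop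
        (𝓝 ((‖x‖⁻¹ : ℝ) : ℂ)) :=
      (Complex.continuous_ofReal.tendsto _).comp (h1.norm.inv₀ (by simp [hx]))
    simpa [hx] using h3.smul h1
  have h4 : ∀ᶠ n : ℕ in atTop, E.proj (Iio n) x ≠ 0 := h1.eventually_ne hx0
  obtain ⟨n, hn0, hn⟩ := (h4.and (h2.eventually (ball_mem_nhds x hr))).exists
  refine ⟨_, ?_, (finite_Iio n).subset ?_, by rwa [← dist_eq_norm]⟩
  · rw [norm_smul, Complex.norm_real, norm_inv, norm_norm, inv_mul_cancel₀ (norm_ne_zero_iff.2 hn0)]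
  · intro k hk
    by_contra h
    exact hk (by simp [h])

end SequenceSpaceStructure

/-! ### Consequences of complex convexity in sequence spaces -/

theorem IsStrictlyCConvex.eq_zero {X : Type*} [NormedAddCommGroup X] [NormedSpace ℂ X]
    (hX : IsStrictlyCConvex X) {x y : X} (hx : ‖x‖ = 1)
    (h : ∀ ζ : ℂ, ‖ζ‖ ≤ 1 → ‖x + ζ • y‖ ≤ 1) : y = 0 := by
  by_contra hy
  obtain ⟨ζ, hζ, hn⟩ := (hX x hx).2 y hy
  exact hn (by simpa using h ζ hζ)

theorem IsStrictlyCConvex.complexFace_eq {X : Type*} [NormedAddCommGroup X] [NormedSpace ℂ X]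
    (hX : IsStrictlyCConvex X) {x : X} (hx : ‖x‖ = 1) : complexFace x = {x} := by
  ext z
  constructor
  · rintro ⟨y, hy, rfl⟩
    simp [hX.eq_zero hx hy]
  · rintro rfl
    exact ⟨0, fun ζ _ => by simp [hx], by simp⟩

namespace SequenceSpaceStructure

variable {X : Type*} [NormedAddCommGroup X] [NormedSpace ℂ X] (E : SequenceSpaceStructure X)

theorem coord_sum_smul_proj (s : Finset ℕ) (b : ℕ → ℂ) (x : X) (j : ℕ) :
    E.coord (∑ k ∈ s, b k • E.proj {k} x) j = if j ∈ s then b j * E.coord x j else 0 := by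
  simp only [map_sum, map_smul, Finset.sum_apply, Pi.smul_apply, coord_proj, smul_eq_mul,
    indicator_apply, mem_singleton_iff, mul_ite, mul_zero]
  exact Finset.sum_ite_eq s j fun k => b k * E.coord x j

/-- The weights are `p k = |φ (x k • e k)|`, where `φ` is a functional norming `x`. Strict
c-convexity is what makes all of them positive. -/
theorem exists_weights (hX : IsStrictlyCConvex X) {x : X} (hx : ‖x‖ = 1) {s : Finset ℕ}
    (hs : ∀ k, k ∈ s ↔ E.coord x k ≠ 0) :
    ∃ p : s → ℝ, (∀ k, 0 < p k) ∧ ∑ k, p k = 1 ∧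
      ∀ y : X, ‖y‖ ≤ 1 → ∑ k : s, p k * ‖E.coord y k / E.coord x k‖ ≤ 1 := by
  obtain ⟨φ, hφ, hφx⟩ := exists_dual_vector'' ℂ x
  have hle : ∀ z : X, ‖φ z‖ ≤ ‖z‖ := fun z => by simpa using φ.le_of_opNorm_le hφ z
  set c : ℕ → ℂ := fun k => φ (E.proj {k} x) with hc
  have hsum : ∑ k ∈ s, c k = 1 := by
    have e : ∑ k ∈ s, (1 : ℂ) • E.proj {k} x = x := E.coord_injective <| funext fun j => by
      rw [E.coord_sum_smul_proj s (fun _ => 1) x j]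
      by_cases hj : j ∈ s
      · simp [hj]
      · simp [hj, not_not.1 ((hs j).not.1 hj)]
    have := congrArg φ e
    rw [hφx, hx] at this
    simpa [hc] using this
  have key : ∀ y : X, ‖y‖ ≤ 1 → ∑ k ∈ s, ‖c k‖ * ‖E.coord y k / E.coord x k‖ ≤ 1 := by
    intro y hy
    set u : ℕ → ℂ := fun k => E.coord y k / E.coord x k * c k with hu
    -- Phases `a k` making all the terms `a k * u k` nonnegative; solidity allows to rotate
    -- the coordinates of `y` by them.
    set a : ℕ → ℂ := fun k => (starRingEnd ℂ) (u k) / ‖u k‖ with ha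
    have ha1 : ∀ k, ‖a k‖ ≤ 1 := fun k => by
      simp only [ha, norm_div, RCLike.norm_conj, Complex.norm_real, norm_norm]
      exact div_self_le_one _
    have hau : ∀ k, a k * u k = ‖u k‖ := fun k => by
      by_cases h : u k = 0
      · simp [h]
      · have h' : (‖u k‖ : ℂ) ≠ 0 := by simpa using h
        simp only [ha]
        rw [div_mul_eq_mul_div, Complex.conj_mul', sq, mul_div_assoc, div_self h', mul_one]
    set z := ∑ k ∈ s, (a k * (E.coord y k / E.coord x k)) • E.proj {k} x with hz
    have hzy : ‖z‖ ≤ ‖y‖ := E.norm_le_of_coord_le fun j => by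
      rw [hz, E.coord_sum_smul_proj s _ x j]
      by_cases hj : j ∈ s
      · rw [if_pos hj, mul_assoc, div_mul_cancel₀ _ ((hs j).1 hj), norm_mul]
        exact mul_le_of_le_one_left (norm_nonneg _) (ha1 j)
      · simp [hj]
    have hφz : φ z = ((∑ k ∈ s, ‖c k‖ * ‖E.coord y k / E.coord x k‖ : ℝ) : ℂ) := by
      rw [hz, map_sum, Complex.ofReal_sum]
      refine Finset.sum_congr rfl fun k _ => ?_
      rw [map_smul, smul_eq_mul, mul_assoc]
      change a k * u k = _
      rw [hau, hu, norm_mul, mul_comm]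
    have h := (hle z).trans (hzy.trans hy)
    rw [hφz, Complex.norm_real] at h
    exact (le_abs_self _).trans h
  have hsum' : ∑ k ∈ s, ‖c k‖ = 1 := by
    apply le_antisymm
    · refine le_trans (Finset.sum_le_sum fun k hk => ?_) (key x hx.le)
      rw [div_self ((hs k).1 hk), norm_one, mul_one]
    · have := norm_sum_le s c
      rwa [hsum, norm_one] at this
  have hpos : ∀ k ∈ s, 0 < ‖c k‖ := by
    intro k hk
    refine norm_pos_iff.2 fun h0 => (hs k).1 hk ?_
    -- If `φ` vanished on the `k`-th component, removing it from `x` would leave a unit vector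
    -- that is not complex extreme.
    have hx' : ‖x - E.proj {k} x‖ = 1 := by
      apply le_antisymm
      · rw [← hx]
        refine E.norm_le_of_coord_le fun j => ?_
        by_cases hj : j = k <;> simp [hj]
      · have h1 := hle (x - E.proj {k} x)
        have h2 : φ (x - E.proj {k} x) = 1 := by
          rw [map_sub, hφx, hx]
          change _ - c k = _
          simp [h0]
        rwa [h2, norm_one] at h1
    have h3 : E.proj {k} x = 0 := hX.eq_zero hx' fun ζ hζ => by
      rw [← hx]
      refine E.norm_le_of_coord_le fun j => ?_
      by_cases hj : j = k
      · subst hj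
        simpa using mul_le_of_le_one_left (norm_nonneg _) hζ
      · simp [hj]
    have h4 : E.coord (E.proj {k} x) k = 0 := by rw [h3]; simp
    simpa using h4
  refine ⟨fun k => ‖c k‖, fun k => hpos k k.2, ?_, fun y hy => ?_⟩
  · rw [Finset.sum_coe_sort s fun k => ‖c k‖, hsum']
  · rw [Finset.sum_coe_sort s fun k => ‖c k‖ * ‖E.coord y k / E.coord x k‖]
    exact key y hy

/-- Among points of the unit ball, closeness to `x` is controlled by the coordinates in the
support of `x`. -/
theorem exists_norm_sub_lt (hX : IsLocallyCConvex X) {x : X} (hx : ‖x‖ = 1) {s : Finset ℕ}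
    (hs : ∀ k, k ∈ s ↔ E.coord x k ≠ 0) {r : ℝ} (hr : 0 < r) :
    ∃ ρ : ℝ, 0 < ρ ∧ ∀ y : X, ‖y‖ ≤ 1 → ‖E.proj s y - x‖ < ρ → ‖y - x‖ < r := by
  obtain ⟨δ, hδ, H⟩ := hX.2 x hx (r / 2) (by positivity)
  refine ⟨min δ (r / 2), by positivity, fun y hy hyx => ?_⟩
  have h1 := hyx.trans_le (min_le_left _ _)
  have h2 := hyx.trans_le (min_le_right _ _)
  have hx0 : ∀ k, k ∉ s → E.coord x k = 0 := fun k hk => not_not.1 ((hs k).not.1 hk)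
  have h3 : ‖y - E.proj s y‖ < r / 2 := by
    by_contra! h
    have h4 := H (x - (y - E.proj s y)) (by
      rw [hX.1.complexFace_eq hx, infDist_singleton, dist_eq_norm]
      simpa [norm_sub_rev] using h)
    have h5 : (⨆ θ : Icc (0 : ℝ) (2 * Real.pi), ‖x + Complex.exp ((θ : ℝ) * Complex.I) •
        (x - (x - (y - E.proj s y)))‖) ≤ 1 + ‖E.proj s y - x‖ := by
      have : Nonempty (Icc (0 : ℝ) (2 * Real.pi)) := ⟨⟨0, le_rfl, Real.two_pi_pos.le⟩⟩
      refine ciSup_le fun θ => ?_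
      rw [sub_sub_cancel]
      -- The two summands have disjoint supports, so the rotation does not change the norm.
      have h6 : ‖x + Complex.exp ((θ : ℝ) * Complex.I) • (y - E.proj s y)‖ =
          ‖y - (E.proj s y - x)‖ := E.norm_eq_of_norm_coord_eq fun k => by
        by_cases hk : k ∈ s
        · simp [hk]
        · simp [hk, hx0 k hk, Complex.norm_exp_ofReal_mul_I]
      rw [h6]
      exact (norm_sub_le _ _).trans (by linarith)
    linarith
  calc ‖y - x‖ = ‖(y - E.proj s y) + (E.proj s y - x)‖ := by rw [sub_add_sub_cancel]
    _ ≤ ‖y - E.proj s y‖ + ‖E.proj s y - x‖ := norm_add_le _ _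
    _ < r := by linarith

/-- The same with the ratios of the coordinates in place of the band projection. -/
theorem exists_norm_sub_lt_of_ratio (hX : IsLocallyCConvex X) {x : X} (hx : ‖x‖ = 1)
    {s : Finset ℕ} (hs : ∀ k, k ∈ s ↔ E.coord x k ≠ 0) {r : ℝ} (hr : 0 < r) :
    ∃ ρ : ℝ, 0 < ρ ∧ ∀ y : X, ‖y‖ ≤ 1 →
      ‖(fun k : s => E.coord y k / E.coord x k) - 1‖ < ρ → ‖y - x‖ < r := by
  obtain ⟨ρ, hρ, H⟩ := E.exists_norm_sub_lt hX hx hs hr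
  refine ⟨ρ, hρ, fun y hy hyρ => H y hy (lt_of_le_of_lt ?_ hyρ)⟩
  set M := ‖(fun k : s => E.coord y k / E.coord x k) - 1‖ with hM
  have hM0 : 0 ≤ M := norm_nonneg _
  have h1 : ‖E.proj s y - x‖ ≤ ‖(M : ℂ) • x‖ := E.norm_le_of_coord_le fun k => by
    by_cases hk : k ∈ s
    · have h2 := norm_le_pi_norm ((fun k : s => E.coord y k / E.coord x k) - 1) ⟨k, hk⟩
      have hxk := (hs k).1 hk
      have e : E.coord (E.proj s y - x) k = (E.coord y k / E.coord x k - 1) * E.coord x k := by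
        simp [hk]; field_simp
      rw [e, map_smul, Pi.smul_apply, smul_eq_mul, norm_mul, norm_mul, Complex.norm_of_nonneg hM0]
      exact mul_le_mul_of_nonneg_right h2 (norm_nonneg _)
    · simp [hk, not_not.1 ((hs k).not.1 hk)]
  rwa [norm_smul, hx, mul_one, Complex.norm_of_nonneg hM0] at h1

end SequenceSpaceStructure

/-! ### Boundaries of the ball algebras -/

section Functions

variable {X : Type*} [NormedAddCommGroup X] [NormedSpace ℂ X]

/-- The restriction of a continuous linear functional to the closed unit ball. -/
noncomputable def restrictBall (φ : X →L[ℂ] ℂ) : closedBall (0 : X) 1 →ᵇ ℂ :=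
  BoundedContinuousFunction.ofNormedAddCommGroup (fun x => φ x)
    (φ.continuous.comp continuous_subtype_val) ‖φ‖ fun x =>
      φ.le_opNorm_of_le (mem_closedBall_zero_iff.1 x.2) |>.trans_eq (mul_one _)

@[simp] theorem restrictBall_apply (φ : X →L[ℂ] ℂ) (x : closedBall (0 : X) 1) :
    restrictBall φ x = φ x := rfl

theorem restrictBall_mem (φ : X →L[ℂ] ℂ) : restrictBall φ ∈ ballAlgebraU X :=
  ⟨⟨φ, φ.differentiable.differentiableOn, fun _ => rfl⟩,
    φ.uniformContinuous.comp uniformContinuous_subtype_val⟩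

theorem ballAlgebraU_le : ballAlgebraU X ≤ ballAlgebraB X := fun _ hf => hf.1

end Functions

section Boundaries

/-- A boundary for an algebra is a boundary for each subalgebra. -/
theorem IsBoundary.mono {K : Type*} [TopologicalSpace K] {A B : Subalgebra ℂ (K →ᵇ ℂ)}
    (h : A ≤ B) {F : Set K} (hF : IsBoundary B F) : IsBoundary A F := fun f hf => hF f (h hf)

theorem isClosed_unitSphereInBall {X : Type*} [NormedAddCommGroup X] :
    IsClosed (unitSphereInBall X) :=
  isClosed_eq continuous_subtype_val.norm continuous_const

variable {X : Type*} [NormedAddCommGroup X] [NormedSpace ℂ X]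

/-- Maximum modulus principle. -/
theorem isBoundary_unitSphereInBall [Nontrivial X] :
    IsBoundary (ballAlgebraB X) (unitSphereInBall X) := by
  rintro f ⟨g, hg, hgf⟩
  have hbdd : BddAbove (range fun x : unitSphereInBall X => ‖f x‖) :=
    ⟨‖f‖, by rintro _ ⟨x, rfl⟩; exact f.norm_coe_le_norm _⟩
  have hcl : closure (ball (0 : X) 1) = closedBall 0 1 := closure_ball 0 one_ne_zero
  have hd : DiffContOnCl ℂ g (ball 0 1) := by
    refine ⟨hg, ?_⟩
    rw [hcl, continuousOn_iff_continuous_domRestrict]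
    have : (closedBall (0 : X) 1).domRestrict g = f := funext hgf
    rw [this]
    exact f.continuous
  apply le_antisymm
  · refine (BoundedContinuousFunction.norm_le (Real.iSup_nonneg fun _ => norm_nonneg _)).2
      fun x => ?_
    rw [← hgf]
    refine Complex.norm_le_of_forall_mem_frontier_norm_le isBounded_ball hd (fun z hz => ?_)
      (by rw [hcl]; exact x.2)
    rw [frontier_ball (0 : X) one_ne_zero, mem_sphere_zero_iff_norm] at hz
    have hzB : z ∈ closedBall (0 : X) 1 := mem_closedBall_zero_iff.2 hz.le
    rw [hgf ⟨z, hzB⟩]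
    exact le_ciSup hbdd ⟨⟨z, hzB⟩, hz⟩
  · exact Real.iSup_le (fun x => f.norm_coe_le_norm _) (norm_nonneg _)

/-- Functions in `A_u` concentrate near every finitely supported unit vector. -/
theorem SequenceSpaceStructure.exists_concentrated (E : SequenceSpaceStructure X)
    (hX : IsLocallyCConvex X) {x : X} (hx : ‖x‖ = 1)
    (hfin : (Function.support (E.coord x)).Finite) {r : ℝ} (hr : 0 < r) :
    ∃ f ∈ ballAlgebraU X, f ⟨x, mem_closedBall_zero_iff.2 hx.le⟩ = 1 ∧
      ∀ y : closedBall (0 : X) 1, r ≤ ‖(y : X) - x‖ → ‖f y‖ ≤ 1 / 2 := by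
  set s := hfin.toFinset with hsdef
  have hs : ∀ k, k ∈ s ↔ E.coord x k ≠ 0 := fun k => by simp [hsdef]
  obtain ⟨p, hp, hp1, hpy⟩ := E.exists_weights hX.1 hx hs
  obtain ⟨ρ, hρ, hyx⟩ := E.exists_norm_sub_lt_of_ratio hX hx hs hr
  obtain ⟨η, hη0, hη1, hη⟩ := exists_peakModel_le hp hp1 hρ
  set M := (1 + ∑ j, (p j)⁻¹) ^ Fintype.card s
  have hM0 : 0 ≤ M := pow_nonneg
    (add_nonneg zero_le_one (Finset.sum_nonneg fun j _ => (inv_pos.2 (hp j)).le)) _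
  obtain ⟨N, hN⟩ : ∃ N : ℕ, M * η ^ N < 1 / 2 := by
    have := (tendsto_pow_atTop_nhds_zero_of_lt_one hη0 hη1).const_mul M
    rw [mul_zero] at this
    exact (this.eventually_lt_const (by norm_num)).exists
  set W : s → closedBall (0 : X) 1 →ᵇ ℂ := fun k =>
    restrictBall ((E.coord x k)⁻¹ • E.coordCLM k) with hW
  have hWm : ∀ k, W k ∈ ballAlgebraU X := fun k => restrictBall_mem _
  set f : closedBall (0 : X) 1 →ᵇ ℂ := (∏ k, W k ^ ⌈N * p k⌉₊) *
    ((1 / 2 : ℂ) • (1 + ∑ k, (p k : ℂ) • W k)) ^ N with hf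
  have hfW : ∀ y, f y = (∏ k, W k y ^ ⌈N * p k⌉₊) * ((1 + ∑ k, p k * W k y) / 2) ^ N := by
    intro y
    have e1 : (∏ k, W k ^ ⌈N * p k⌉₊) y = ∏ k, W k y ^ ⌈N * p k⌉₊ := by
      let ev : (closedBall (0 : X) 1 →ᵇ ℂ) →* ℂ := ⟨⟨fun g => g y, rfl⟩, fun _ _ => rfl⟩
      exact map_prod ev (fun k => W k ^ ⌈N * p k⌉₊) Finset.univ
    have e2 : (∑ k, (p k : ℂ) • W k) y = ∑ k, p k * W k y := by
      simp [BoundedContinuousFunction.sum_apply]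
    simp only [hf, BoundedContinuousFunction.mul_apply, BoundedContinuousFunction.pow_apply, e1,
      BoundedContinuousFunction.smul_apply, BoundedContinuousFunction.add_apply, e2,
      BoundedContinuousFunction.coe_one, Pi.one_apply, smul_eq_mul]
    congr 2
    ring
  have hWy : ∀ (k : s) (y : closedBall (0 : X) 1), W k y = E.coord y k / E.coord x k :=
    fun k y => by simp [hW, div_eq_inv_mul]
  refine ⟨f, ?_, ?_, fun y hy => ?_⟩
  · exact mul_mem (prod_mem fun k _ => pow_mem (hWm k) _) <| pow_mem
      (Subalgebra.smul_mem _ (add_mem (one_mem _)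
        (sum_mem fun k _ => Subalgebra.smul_mem _ (hWm k) _)) _) _
  · have h1 : ∀ k, W k ⟨x, mem_closedBall_zero_iff.2 hx.le⟩ = 1 := fun k => by
      rw [hWy]; exact div_self ((hs k).1 k.2)
    have h2 : ∑ k, (p k : ℂ) = 1 := by exact_mod_cast hp1
    simp only [hfW, h1, one_pow, Finset.prod_const_one, mul_one, h2]
    norm_num
  · have hy1 := mem_closedBall_zero_iff.1 y.2
    have h1 := hpy y hy1
    have h2 : ρ ≤ ‖(fun k : s => E.coord y k / E.coord x k) - 1‖ := by
      by_contra! h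
      exact (hyx y hy1 h).not_ge hy
    rw [hfW]
    simp only [hWy]
    refine (norm_peakPolynomial_le hp h1 N).trans (le_trans ?_ hN.le)
    exact mul_le_mul_of_nonneg_left
      (pow_le_pow_left₀ (peakModel_nonneg _) (hη _ h1 h2) N) hM0

theorem SequenceSpaceStructure.unitSphereInBall_subset (E : SequenceSpaceStructure X)
    (hE : E.OrderContinuous) (hX : IsLocallyCConvex X) {F : Set (closedBall (0 : X) 1)}
    (hFc : IsClosed F) (hF : IsBoundary (ballAlgebraU X) F) : unitSphereInBall X ⊆ F := by
  intro x hx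
  rw [← hFc.closure_eq, Metric.mem_closure_iff]
  intro ε hε
  obtain ⟨z, hz, hfin, hzx⟩ := E.exists_finite_support_near hE hx (half_pos hε)
  by_contra! h
  obtain ⟨f, hf, hf1, hf2⟩ := E.exists_concentrated hX hz hfin (half_pos hε)
  have h1 : ‖f‖ ≤ 1 / 2 := by
    rw [hF f hf]
    refine Real.iSup_le (fun y => hf2 y ?_) (by norm_num)
    have h2 := h y y.2
    rw [Subtype.dist_eq, dist_eq_norm] at h2
    have h3 := norm_sub_le_norm_sub_add_norm_sub (x : X) z (y : X)
    rw [norm_sub_rev (x : X) z, norm_sub_rev z (y : X)] at h3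
    linarith
  have h2 := f.norm_coe_le_norm ⟨z, mem_closedBall_zero_iff.2 hz.le⟩
  rw [hf1, norm_one] at h2
  linarith

end Boundaries

theorem theorem3p9 {X : Type*} [NormedAddCommGroup X] [NormedSpace ℂ X] [CompleteSpace X]
    [Nontrivial X] (E : SequenceSpaceStructure X) (hE : E.OrderContinuous)
    (hX : IsLocallyCConvex X) :
    IsShilovBoundary (ballAlgebraU X) (unitSphereInBall X) ∧
      IsShilovBoundary (ballAlgebraB X) (unitSphereInBall X) := by
  have hB : IsBoundary (ballAlgebraB X) (unitSphereInBall X) := isBoundary_unitSphereInBall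
  have hU := hB.mono ballAlgebraU_le
  refine ⟨⟨subset_antisymm ?_ ?_, hU⟩, ⟨subset_antisymm ?_ ?_, hB⟩⟩
  · exact subset_sInter fun F hF => E.unitSphereInBall_subset hE hX hF.1 hF.2
  · exact sInter_subset_of_mem ⟨isClosed_unitSphereInBall, hU⟩
  · exact subset_sInter fun F hF =>
      E.unitSphereInBall_subset hE hX hF.1 (hF.2.mono ballAlgebraU_le)
  · exact sInter_subset_of_mem ⟨isClosed_unitSphereInBall, hB⟩
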